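/- Let $X$ be a finite-dimensional real normed space with $n=\dim X\ge 3$ which is smooth, i.e. for every $x\in X$ with $\|x\|=1$ there is exactly one continuous linear functional $f$ on $X$ with $\|f\|=1$ and $f(x)=1$. Then the norm of $X$ is induced by an inner product if and only if every $e\in X$ with $\|e\|=1$ belongs to a (Hamel) basis $\{e_1,\dots,e_n\}$ of $X$ such that (i) $\{e_1,\dots,e_n\}$ is strongly orthonormal in the sense of Birkhoff--James, that is, $\|e_i\|=1$ for every $i$, and for every $i$ and all real numbers $\lambda_j$ ($j\ne i$) that are not all zero, $$\|e_i\|<\Big\|e_i+\sum_{j\ne i}\lambda_j e_j\Big\|;$$ (ii) for every $i\in\{1,\dots,n\}$ the zero vector is the best coapproximation to $e_i$ out of $G_i=\operatorname{span}\{e_j : j\ne i\}$. Here $w\in G$ is called the best coapproximation to $x$ out of a subspace $G$ if $\|w-g\|\le\|x-g\|$ for all $g\in G$; so the condition says $\|g\|\le\|e_i-g\|$ for all $g\in G_i$. -/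

import Mathlib

/-- The norm of the real normed space `X` comes from an inner product. The equation makes the real
vector space structure underlying the inner product the given one. -/
def IsInnerProductNormedSpace (X : Type*) [NormedAddCommGroup X] [inst : NormedSpace ℝ X] : Prop :=
  ∃ I : InnerProductSpace ℝ X, I.toNormedSpace = inst

/-- `X` is smooth: every point of the unit sphere has exactly one supporting functional of
norm one. -/
def IsSmoothNormedSpace (X : Type*) [NormedAddCommGroup X] [NormedSpace ℝ X] : Prop :=
  ∀ x : X, ‖x‖ = 1 → ∃! f : X →L[ℝ] ℝ, ‖f‖ = 1 ∧ f x = 1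

/-- The finite family `v` is strongly orthogonal in the sense of Birkhoff-James. -/
def IsStronglyOrthogonal {ι X : Type*} [Fintype ι] [DecidableEq ι]
    [NormedAddCommGroup X] [NormedSpace ℝ X] (v : ι → X) : Prop :=
  ∀ (i : ι) (c : ι → ℝ), (∃ j, j ≠ i ∧ c j ≠ 0) →
    ‖v i‖ < ‖v i + ∑ j ∈ Finset.univ.erase i, c j • v j‖

/-- The finite family `v` is strongly orthonormal in the sense of Birkhoff-James. -/
def IsStronglyOrthonormal {ι X : Type*} [Fintype ι] [DecidableEq ι]
    [NormedAddCommGroup X] [NormedSpace ℝ X] (v : ι → X) : Prop :=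
  IsStronglyOrthogonal v ∧ ∀ i, ‖v i‖ = 1

/-- `w` is the best coapproximation to `x` out of the subspace `G`. -/
def IsBestCoapproximation {X : Type*} [NormedAddCommGroup X] [NormedSpace ℝ X]
    (G : Submodule ℝ X) (x w : X) : Prop :=
  w ∈ G ∧ ∀ g ∈ G, ‖w - g‖ ≤ ‖x - g‖

/-- `s` assigns to every nonzero vector its only supporting functional of norm one. -/
structure IsSupportMap {X : Type*} [NormedAddCommGroup X] [NormedSpace ℝ X]
    (s : X → X →L[ℝ] ℝ) : Prop where
  norm_eq : ∀ x, x ≠ 0 → ‖s x‖ = 1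
  apply_self : ∀ x, x ≠ 0 → s x x = ‖x‖
  unique : ∀ x, x ≠ 0 → ∀ f : X →L[ℝ] ℝ, ‖f‖ = 1 → f x = ‖x‖ → f = s x

theorem IsSmoothNormedSpace.exists_isSupportMap {X : Type*} [NormedAddCommGroup X]
    [NormedSpace ℝ X] (h : IsSmoothNormedSpace X) :
    ∃ s : X → X →L[ℝ] ℝ, IsSupportMap s := by
  have key : ∀ x : X, ∃ f : X →L[ℝ] ℝ, x ≠ 0 →
      (‖f‖ = 1 ∧ f x = ‖x‖ ∧ ∀ g : X →L[ℝ] ℝ, ‖g‖ = 1 → g x = ‖x‖ → g = f) := by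
    intro x
    by_cases hx : x = 0
    · exact ⟨0, fun h => absurd hx h⟩
    have hx' : ‖x‖ ≠ 0 := norm_ne_zero_iff.mpr hx
    have eqv : ∀ f : X →L[ℝ] ℝ, f (‖x‖⁻¹ • x) = 1 ↔ f x = ‖x‖ := by
      intro f
      rw [map_smul, smul_eq_mul, inv_mul_eq_one₀ hx', eq_comm]
    obtain ⟨f, ⟨hf1, hf2⟩, hu⟩ := h (‖x‖⁻¹ • x) (norm_smul_inv_norm (𝕜 := ℝ) hx)
    exact ⟨f, fun _ => ⟨hf1, (eqv f).1 hf2, fun g h1 h2 => hu g ⟨h1, (eqv g).2 h2⟩⟩⟩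
  choose s hs using key
  exact ⟨s, fun x hx => (hs x hx).1, fun x hx => (hs x hx).2.1, fun x hx => (hs x hx).2.2⟩

namespace IsSupportMap

variable {X : Type*} [NormedAddCommGroup X] [NormedSpace ℝ X] {s : X → X →L[ℝ] ℝ}

theorem apply_le (hs : IsSupportMap s) {x : X} (hx : x ≠ 0) (y : X) : s x y ≤ ‖y‖ := by
  have := (s x).le_opNorm y
  rw [hs.norm_eq x hx, one_mul] at this
  exact (le_abs_self _).trans this

theorem smul_of_pos (hs : IsSupportMap s) {c : ℝ} (hc : 0 < c) {x : X} (hx : x ≠ 0) :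
    s (c • x) = s x := by
  refine (hs.unique (c • x) (smul_ne_zero hc.ne' hx) _ (hs.norm_eq x hx) ?_).symm
  rw [map_smul, hs.apply_self x hx, norm_smul, Real.norm_of_nonneg hc.le, smul_eq_mul]

theorem continuousAt [FiniteDimensional ℝ X] (hs : IsSupportMap s) {x : X} (hx : x ≠ 0) :
    ContinuousAt s x := by
  have : ProperSpace (X →L[ℝ] ℝ) := FiniteDimensional.proper ℝ _
  have hne : ∀ᶠ y in nhds x, y ≠ 0 := isOpen_ne.mem_nhds hx
  refine (isCompact_sphere (0 : X →L[ℝ] ℝ) 1).tendsto_nhds_of_unique_mapClusterPt ?_ ?_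
  · filter_upwards [hne] with y hy
    simpa using hs.norm_eq y hy
  · intro f hf hcl
    refine hs.unique x hx f (by simpa using hf) ?_
    obtain ⟨U, hU, hUf⟩ := mapClusterPt_iff_ultrafilter.1 hcl
    have hid : Filter.Tendsto (fun y : X => y) U (nhds x) := hU
    have h1 : Filter.Tendsto (fun y => s y y) U (nhds (f x)) :=
      (isBoundedBilinearMap_apply (𝕜 := ℝ)).continuous.tendsto (f, x) |>.comp
        (Filter.Tendsto.prodMk_nhds hUf hid)
    have h2 : Filter.Tendsto (fun y => s y y) U (nhds ‖x‖) := by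
      refine hid.norm.congr' ?_
      filter_upwards [hU hne] with y hy
      exact (hs.apply_self y hy).symm
    exact tendsto_nhds_unique h1 h2

theorem apply_eq_zero_of_norm_le [FiniteDimensional ℝ X] (hs : IsSupportMap s) {x y : X}
    (hx : x ≠ 0) (h : ∀ t : ℝ, ‖x‖ ≤ ‖x + t • y‖) : s x y = 0 := by
  have key : ∀ z : X, (∀ t : ℝ, ‖x‖ ≤ ‖x + t • z‖) → 0 ≤ s x z := by
    intro z hz
    have hlin : Filter.Tendsto (fun t : ℝ => x + t • z) (nhdsWithin 0 (Set.Ioi 0)) (nhds x) := by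
      have : Continuous fun t : ℝ => x + t • z := by fun_prop
      simpa using (this.tendsto 0).mono_left nhdsWithin_le_nhds
    have hlim : Filter.Tendsto (fun t : ℝ => s (x + t • z) z) (nhdsWithin 0 (Set.Ioi 0))
        (nhds (s x z)) :=
      ((ContinuousLinearMap.apply ℝ ℝ z).continuous.tendsto (s x)).comp
        ((hs.continuousAt hx).tendsto.comp hlin)
    refine ge_of_tendsto hlim ?_
    filter_upwards [self_mem_nhdsWithin] with t (ht : 0 < t)
    have hne : x + t • z ≠ 0 :=
      norm_pos_iff.1 ((norm_pos_iff.2 hx).trans_le (hz t))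
    have h1 := hs.apply_self _ hne
    have h2 := hs.apply_le hne x
    rw [map_add, map_smul, smul_eq_mul] at h1
    have h3 : 0 ≤ t * s (x + t • z) z := by linarith [hz t]
    exact nonneg_of_mul_nonneg_right h3 ht
  have h1 := key y h
  have h2 := key (-y) fun t => by simpa using h (-t)
  rw [map_neg] at h2
  linarith

end IsSupportMap

namespace IsSupportMap

variable {X : Type*} [NormedAddCommGroup X] [NormedSpace ℝ X] {s : X → X →L[ℝ] ℝ}

/-- On the kernel of `s e`, the functionals `s (e + u)` and `s u` are proportional. -/
theorem apply_add_mul_norm (hs : IsSupportMap s)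
    (hsymm : ∀ x y : X, x ≠ 0 → y ≠ 0 → s x y = 0 → s y x = 0) {e u z : X} (he : e ≠ 0)
    (hu : u ≠ 0) (heu : s e u = 0) (hez : s e z = 0) :
    s (e + u) z * ‖u‖ = s u z * s (e + u) u := by
  have hne : e + u ≠ 0 := by
    intro h
    have := hs.apply_self e he
    rw [← add_zero (s e e), ← heu, ← map_add, h, map_zero] at this
    exact he (norm_eq_zero.1 this.symm)
  have ker : ∀ k : X, s e k = 0 → s u k = 0 → s (e + u) k = 0 := by
    intro k hek huk
    by_cases hk : k = 0
    · rw [hk, map_zero]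
    refine hsymm k (e + u) hk hne ?_
    rw [map_add, hsymm e k he hk hek, hsymm u k hu hk huk, add_zero]
  have h := ker (‖u‖ • z - s u z • u)
    (by rw [map_sub, map_smul, map_smul, hez, heu, smul_zero, smul_zero, sub_zero])
    (by rw [map_sub, map_smul, map_smul, hs.apply_self u hu, smul_eq_mul, smul_eq_mul]; ring)
  rw [map_sub, map_smul, map_smul, smul_eq_mul, smul_eq_mul] at h
  linarith

theorem norm_add_sub_norm_add_le (hs : IsSupportMap s)
    (hsymm : ∀ x y : X, x ≠ 0 → y ≠ 0 → s x y = 0 → s y x = 0) {e u v : X} (he : e ≠ 0)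
    (hu : u ≠ 0) (hv : v ≠ 0) (heu : s e u = 0) (hev : s e v = 0) (huv : ‖u‖ = ‖v‖) :
    ‖e + v‖ - ‖e + u‖ ≤ ‖s v - s u‖ * ‖v - u‖ := by
  have hne : e + v ≠ 0 := by
    intro h
    have := hs.apply_self e he
    rw [← add_zero (s e e), ← hev, ← map_add, h, map_zero] at this
    exact he (norm_eq_zero.1 this.symm)
  have hv0 : 0 < ‖v‖ := norm_pos_iff.2 hv
  have hprop := hs.apply_add_mul_norm hsymm (z := v - u) he hv hev
    (by rw [map_sub, heu, hev, sub_zero])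
  have h1 := hs.apply_self _ hne
  have h2 := hs.apply_le hne (e + u)
  have h3 : ‖e + v‖ - ‖e + u‖ ≤ s (e + v) (v - u) := by
    rw [map_sub]; rw [map_add] at h1 h2; linarith
  have h4 : 0 ≤ s v (v - u) := by
    rw [map_sub, hs.apply_self v hv]; linarith [hs.apply_le hv u]
  have h5 : s u (v - u) ≤ 0 := by
    rw [map_sub, hs.apply_self u hu]; linarith [hs.apply_le hu v]
  have h6 : s (e + v) (v - u) ≤ s v (v - u) := by
    refine le_of_mul_le_mul_right ?_ hv0
    rw [hprop]
    exact mul_le_mul_of_nonneg_left (hs.apply_le hne v) h4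
  have h7 : (s v - s u) (v - u) ≤ ‖s v - s u‖ * ‖v - u‖ :=
    (le_abs_self _).trans ((s v - s u).le_opNorm _)
  rw [sub_apply] at h7
  linarith

end IsSupportMap

/-- The norm increases along a ray that starts at the strict minimum of the norm on a line. -/
theorem norm_add_smul_lt_norm_add_smul {X : Type*} [NormedAddCommGroup X]
    [NormedSpace ℝ X] {k m : X} (hmin : ∀ t : ℝ, t ≠ 0 → ‖k‖ < ‖k + t • m‖)
    {a b : ℝ} (ha : 0 ≤ a) (hab : a < b) : ‖k + a • m‖ < ‖k + b • m‖ := by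
  have hb : 0 < b := ha.trans_lt hab
  have h1 : k + a • m = (1 - a / b) • k + (a / b) • (k + b • m) := by
    have : a • m = (a / b) • b • m := by rw [smul_smul, div_mul_cancel₀ _ hb.ne']
    rw [this]; module
  have h2 : a / b < 1 := (div_lt_one hb).2 hab
  calc ‖k + a • m‖ ≤ ‖(1 - a / b) • k‖ + ‖(a / b) • (k + b • m)‖ := h1 ▸ norm_add_le _ _
    _ = (1 - a / b) * ‖k‖ + a / b * ‖k + b • m‖ := by
      rw [norm_smul, norm_smul, Real.norm_of_nonneg (by linarith),
        Real.norm_of_nonneg (by positivity)]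
    _ < (1 - a / b) * ‖k + b • m‖ + a / b * ‖k + b • m‖ := by
      have := hmin b hb.ne'
      have : 0 < 1 - a / b := by linarith
      gcongr
    _ = _ := by ring

theorem norm_smul_div_norm_sub_le {X : Type*} [NormedAddCommGroup X] [NormedSpace ℝ X]
    {r : ℝ} (hr : 0 ≤ r) {x y : X} (hx : x ≠ 0) (hy : y ≠ 0) :
    ‖(r / ‖y‖) • y - (r / ‖x‖) • x‖ ≤ 2 * r / ‖x‖ * ‖y - x‖ := by
  have hx0 : 0 < ‖x‖ := norm_pos_iff.2 hx
  have hy0 : 0 < ‖y‖ := norm_pos_iff.2 hy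
  have h1 : (r / ‖y‖) • y - (r / ‖x‖) • x = (r / ‖x‖) • (y - x) + (r / ‖y‖ - r / ‖x‖) • y := by
    module
  have h2 : r / ‖y‖ - r / ‖x‖ = r / (‖x‖ * ‖y‖) * (‖x‖ - ‖y‖) := by field_simp
  have h3 : |‖x‖ - ‖y‖| ≤ ‖y - x‖ := by
    rw [norm_sub_rev]; exact abs_norm_sub_norm_le x y
  calc _ ≤ ‖(r / ‖x‖) • (y - x)‖ + ‖(r / ‖y‖ - r / ‖x‖) • y‖ := h1 ▸ norm_add_le _ _
    _ = r / ‖x‖ * ‖y - x‖ + r / ‖x‖ * |‖x‖ - ‖y‖| := by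
      rw [norm_smul, norm_smul, h2, Real.norm_of_nonneg (by positivity), norm_mul,
        Real.norm_of_nonneg (by positivity), Real.norm_eq_abs]
      field_simp
    _ ≤ r / ‖x‖ * ‖y - x‖ + r / ‖x‖ * ‖y - x‖ := by gcongr
    _ = _ := by ring

namespace IsSupportMap

variable {X : Type*} [NormedAddCommGroup X] [NormedSpace ℝ X] {s : X → X →L[ℝ] ℝ}

theorem norm_add_eq_norm_sub [FiniteDimensional ℝ X] (hdim : 3 ≤ Module.finrank ℝ X)
    (hs : IsSupportMap s) (hsymm : ∀ x y : X, x ≠ 0 → y ≠ 0 → s x y = 0 → s y x = 0)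
    {e g : X} (he : e ≠ 0) (heg : s e g = 0) : ‖e + g‖ = ‖e - g‖ := by
  by_cases hg : g = 0
  · simp [hg]
  obtain ⟨h, hh, heh, hgh⟩ : ∃ h : X, h ≠ 0 ∧ s e h = 0 ∧ s g h = 0 := by
    have hker := LinearMap.ker_ne_bot_of_finrank_lt
      (f := (s e).toLinearMap.prod (s g).toLinearMap) (by simp; omega)
    obtain ⟨h, hmem, hh⟩ := Submodule.exists_mem_ne_zero_of_ne_bot hker
    have := LinearMap.mem_ker.1 hmem
    exact ⟨h, hh, congrArg Prod.fst this, congrArg Prod.snd this⟩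
  have hg0 : 0 < ‖g‖ := norm_pos_iff.2 hg
  let c : ℝ → X := fun t => Real.cos t • g + Real.sin t • h
  have hc0 : ∀ t, c t ≠ 0 := by
    intro t ht
    have h1 : s g (c t) = 0 := by rw [ht, map_zero]
    have h2 : Real.cos t = 0 := by
      simpa [c, hgh, hs.apply_self g hg, hg] using h1
    have h3 : Real.sin t = 0 := by simpa [c, h2, hh] using ht
    have := Real.sin_sq_add_cos_sq t
    simp [h2, h3] at this
  have hcd : Differentiable ℝ c := by fun_prop
  let u : ℝ → X := fun t => (‖g‖ / ‖c t‖) • c t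
  have hun : ∀ t, ‖u t‖ = ‖g‖ := by
    intro t
    have := norm_pos_iff.2 (hc0 t)
    rw [norm_smul, Real.norm_of_nonneg (by positivity)]
    field_simp
  have hu0 : ∀ t, u t ≠ 0 := fun t => norm_pos_iff.1 ((hun t).symm ▸ hg0)
  have heu : ∀ t, s e (u t) = 0 := by intro t; simp [u, c, heg, heh]
  have huc : Continuous u := by
    have hcc := hcd.continuous
    exact (continuous_const.div hcc.norm fun t => norm_ne_zero_iff.2 (hc0 t)).smul hcc
  have hderiv : ∀ t, HasDerivAt (fun t => ‖e + u t‖) 0 t := by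
    intro t
    rw [hasDerivAt_iff_isLittleO]
    have h1 : (fun t' => ‖e + u t'‖ - ‖e + u t‖ - (t' - t) • (0 : ℝ)) =O[nhds t]
        fun t' => ‖s (u t') - s (u t)‖ * ‖u t' - u t‖ := by
      refine Asymptotics.IsBigO.of_bound 1 (Filter.Eventually.of_forall fun t' => ?_)
      rw [smul_zero, sub_zero, one_mul, Real.norm_eq_abs, Real.norm_of_nonneg (by positivity)]
      refine abs_sub_le_iff.2 ⟨?_, ?_⟩
      · exact hs.norm_add_sub_norm_add_le hsymm he (hu0 t) (hu0 t') (heu t) (heu t')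
          ((hun t).trans (hun t').symm)
      · rw [norm_sub_rev (s (u t')), norm_sub_rev (u t')]
        exact hs.norm_add_sub_norm_add_le hsymm he (hu0 t') (hu0 t) (heu t') (heu t)
          ((hun t').trans (hun t).symm)
    have h2 : (fun t' => ‖s (u t') - s (u t)‖) =o[nhds t] fun _ => (1 : ℝ) := by
      rw [Asymptotics.isLittleO_one_iff]
      have hcont : ContinuousAt (fun t' => s (u t')) t :=
        (hs.continuousAt (hu0 t)).comp_of_eq huc.continuousAt rfl
      exact tendsto_iff_norm_sub_tendsto_zero.1 hcont
    have h3 : (fun t' => ‖u t' - u t‖) =O[nhds t] fun t' => t' - t := by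
      refine Asymptotics.IsBigO.trans (Asymptotics.IsBigO.of_bound (2 * ‖g‖ / ‖c t‖)
        (Filter.Eventually.of_forall fun t' => ?_)) (hcd t).isBigO_sub
      rw [norm_norm]
      exact norm_smul_div_norm_sub_le hg0.le (hc0 t) (hc0 t')
    simpa using h1.trans_isLittleO (h2.mul_isBigO h3)
  have hconst := is_const_of_deriv_eq_zero (fun t => (hderiv t).differentiableAt)
    (fun t => (hderiv t).deriv) 0 Real.pi
  simpa [u, c, hg0.ne', ← sub_eq_add_neg] using hconst

theorem apply_comm_of_norm_eq [FiniteDimensional ℝ X] (hdim : 3 ≤ Module.finrank ℝ X)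
    (hs : IsSupportMap s) (hsymm : ∀ x y : X, x ≠ 0 → y ≠ 0 → s x y = 0 → s y x = 0)
    (hstrict : ∀ x y : X, x ≠ 0 → y ≠ 0 → s x y = 0 → ‖x‖ < ‖x + y‖)
    {x y : X} (hx : x ≠ 0) (hxy : ‖x‖ = ‖y‖) : s x y = s y x := by
  have hy : y ≠ 0 := norm_pos_iff.1 (hxy ▸ norm_pos_iff.2 hx)
  by_cases hm : x + y = 0
  · obtain rfl : y = -x := (neg_eq_of_add_eq_zero_right hm).symm
    have h := hs.unique (-x) hy (-s x) (by rw [norm_neg, hs.norm_eq x hx])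
      (by simp [hs.apply_self x hx])
    rw [← h]; simp
  set m := x + y with hmdef
  have hm0 : 0 < ‖m‖ := norm_pos_iff.2 hm
  have refl : ∀ k (t : ℝ), s m k = 0 → ‖k + t • m‖ = ‖k - t • m‖ := by
    intro k t hk
    rcases eq_or_ne k 0 with rfl | hk0
    · simp
    rcases eq_or_ne t 0 with rfl | ht
    · simp
    refine hs.norm_add_eq_norm_sub hdim hsymm hk0 ?_
    rw [map_smul, hsymm m k hm hk0 hk, smul_zero]
  let a : ℝ := s m x / ‖m‖
  let T : X →L[ℝ] X := (2 / ‖m‖) • (s m).smulRight m - ContinuousLinearMap.id ℝ X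
  have hT : ∀ z, T z = (2 * (s m z / ‖m‖)) • m - z := by
    intro z
    simp only [T, sub_apply, smul_apply,
      ContinuousLinearMap.smulRight_apply, ContinuousLinearMap.id_apply, smul_smul]
    congr 2; ring
  have hproj : ∀ z, s m (z - (s m z / ‖m‖) • m) = 0 := by
    intro z
    rw [map_sub, map_smul, hs.apply_self m hm, smul_eq_mul]
    field_simp; ring
  have hTn : ∀ z, ‖T z‖ = ‖z‖ := by
    intro z
    have h := refl _ (s m z / ‖m‖) (hproj z)
    rw [sub_add_cancel] at h
    rw [h, hT, norm_sub_rev]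
    congr 1; module
  have hTT : ∀ z, T (T z) = z := by
    intro z
    rw [hT (T z), hT z, map_sub, map_smul, hs.apply_self m hm, smul_eq_mul]
    have : (2 * (s m z / ‖m‖) * ‖m‖ - s m z) / ‖m‖ = s m z / ‖m‖ := by field_simp; ring
    rw [this]; module
  have hTx : T x = y := by
    set k := x - a • m with hk
    have hmk : s m k = 0 := hproj x
    have hxk : x = k + a • m := by rw [hk]; module
    have hyk : y = (1 - a) • m - k := by rw [hk]; rw [hmdef]; module
    suffices hhalf : a = 1 / 2 by
      rw [hT]; change (2 * a) • m - x = y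
      rw [hhalf, hmdef]; module
    have heven : ∀ t : ℝ, ‖k + t • m‖ = ‖k + |t| • m‖ := by
      intro t
      rcases abs_choice t with h | h <;> rw [h]
      rw [refl k t hmk]; congr 1; module
    have hnorm : ‖k + |a| • m‖ = ‖k + |1 - a| • m‖ := by
      rw [← heven, ← heven, ← hxk, hxy, refl k _ hmk, norm_sub_rev, hyk]
    have hmin : ∀ t : ℝ, t ≠ 0 → ‖k‖ < ‖k + t • m‖ := by
      intro t ht
      rcases eq_or_ne k 0 with h0 | h0
      · rw [h0, norm_zero, zero_add]; exact norm_pos_iff.2 (smul_ne_zero ht hm)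
      · exact hstrict k _ h0 (smul_ne_zero ht hm)
          (by rw [map_smul, hsymm m k hm h0 hmk, smul_zero])
    have habs : |a| = |1 - a| := by
      rcases lt_trichotomy |a| |1 - a| with h | h | h
      · exact absurd hnorm (norm_add_smul_lt_norm_add_smul hmin (abs_nonneg _) h).ne
      · exact h
      · exact absurd hnorm (norm_add_smul_lt_norm_add_smul hmin (abs_nonneg _) h).ne'
    rcases abs_eq_abs.1 habs with h | h <;> linarith
  have hTy : T y = x := by rw [← hTx, hTT]
  have hle : ‖(s x).comp T‖ = 1 := by
    refine le_antisymm ?_ ?_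
    · refine ContinuousLinearMap.opNorm_le_bound _ zero_le_one fun z => ?_
      have := (s x).le_opNorm (T z)
      rwa [hs.norm_eq x hx, hTn] at this
    · have := ((s x).comp T).le_opNorm y
      rw [ContinuousLinearMap.comp_apply, hTy, hs.apply_self x hx, norm_norm, hxy] at this
      exact le_of_mul_le_mul_right (by rwa [one_mul]) (norm_pos_iff.2 hy)
  have := hs.unique y hy _ hle (by
    rw [ContinuousLinearMap.comp_apply, hTy, hs.apply_self x hx, hxy])
  rw [← this, ContinuousLinearMap.comp_apply, hTx]

theorem norm_mul_apply_comm [FiniteDimensional ℝ X] (hdim : 3 ≤ Module.finrank ℝ X)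
    (hs : IsSupportMap s) (hsymm : ∀ x y : X, x ≠ 0 → y ≠ 0 → s x y = 0 → s y x = 0)
    (hstrict : ∀ x y : X, x ≠ 0 → y ≠ 0 → s x y = 0 → ‖x‖ < ‖x + y‖)
    (x y : X) : ‖x‖ * s x y = ‖y‖ * s y x := by
  rcases eq_or_ne x 0 with rfl | hx
  · simp
  rcases eq_or_ne y 0 with rfl | hy
  · simp
  have hx0 := norm_pos_iff.2 hx
  have hy0 := norm_pos_iff.2 hy
  have hc : 0 < ‖x‖ / ‖y‖ := by positivity
  have h := hs.apply_comm_of_norm_eq hdim hsymm hstrict (x := x) (y := (‖x‖ / ‖y‖) • y) hx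
    (by rw [norm_smul, Real.norm_of_nonneg hc.le, div_mul_cancel₀ _ hy0.ne'])
  rw [hs.smul_of_pos hc hy, map_smul, smul_eq_mul] at h
  rw [← h]; field_simp

theorem isInnerProductNormedSpace [FiniteDimensional ℝ X] (hdim : 3 ≤ Module.finrank ℝ X)
    (hs : IsSupportMap s) (hsymm : ∀ x y : X, x ≠ 0 → y ≠ 0 → s x y = 0 → s y x = 0)
    (hstrict : ∀ x y : X, x ≠ 0 → y ≠ 0 → s x y = 0 → ‖x‖ < ‖x + y‖) :
    IsInnerProductNormedSpace X := by
  have hcomm := hs.norm_mul_apply_comm hdim hsymm hstrict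
  refine ⟨{ (inferInstance : NormedSpace ℝ X) with
    inner := fun x y => ‖x‖ * s x y
    norm_sq_eq_re_inner := fun x => ?_
    conj_inner_symm := fun x y => ?_
    add_left := fun x y z => ?_
    smul_left := fun x y r => ?_ }, rfl⟩
  · rcases eq_or_ne x 0 with rfl | hx
    · simp
    · simp [hs.apply_self x hx, sq]
  · simpa using hcomm y x
  · change ‖x + y‖ * s (x + y) z = ‖x‖ * s x z + ‖y‖ * s y z
    rw [hcomm, hcomm x, hcomm y, map_add, mul_add]
  · change ‖r • x‖ * s (r • x) y = r * (‖x‖ * s x y)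
    rw [hcomm, hcomm x, map_smul, smul_eq_mul]; ring

end IsSupportMap

section Basis

variable {X : Type*} [NormedAddCommGroup X] [NormedSpace ℝ X] {s : X → X →L[ℝ] ℝ}
  {ι : Type*} [Fintype ι] [DecidableEq ι]

theorem sum_erase_eq_of_support_apply_eq_zero [FiniteDimensional ℝ X] (hs : IsSupportMap s)
    (b : Module.Basis ι ℝ X) (hb : IsStronglyOrthonormal b) {i : ι} {y : X}
    (hy : s (b i) y = 0) : ∑ j ∈ Finset.univ.erase i, b.repr y j • b j = y := by
  have hbi : b i ≠ 0 := b.ne_zero i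
  have hz : ∀ j, j ≠ i → s (b i) (b j) = 0 := by
    intro j hj
    refine hs.apply_eq_zero_of_norm_le hbi fun t => ?_
    rcases eq_or_ne t 0 with rfl | ht
    · simp
    have h := hb.1 i (Pi.single j t) ⟨j, hj, by simpa using ht⟩
    rw [Finset.sum_eq_single_of_mem j (by simp [hj])
      (fun k _ hk => by rw [Pi.single_eq_of_ne hk, zero_smul]), Pi.single_eq_same] at h
    exact h.le
  have hsum : b.repr y i • b i + ∑ j ∈ Finset.univ.erase i, b.repr y j • b j = y := by
    rw [Finset.add_sum_erase _ (fun j => b.repr y j • b j) (Finset.mem_univ i), b.sum_repr]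
  have h0 : b.repr y i = 0 := by
    have h := congrArg (s (b i)) hsum
    rw [map_add, map_smul, hs.apply_self _ hbi, hb.2 i, map_sum, Finset.sum_eq_zero, hy] at h
    · simpa using h
    · intro j hj
      rw [map_smul, hz j (Finset.ne_of_mem_erase hj), smul_zero]
  rwa [h0, zero_smul, zero_add] at hsum

theorem norm_lt_norm_add_of_support_apply_eq_zero [FiniteDimensional ℝ X] (hs : IsSupportMap s)
    (b : Module.Basis ι ℝ X) (hb : IsStronglyOrthonormal b) {i : ι} {y : X} (hy0 : y ≠ 0)
    (hy : s (b i) y = 0) : ‖b i‖ < ‖b i + y‖ := by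
  have hsum := sum_erase_eq_of_support_apply_eq_zero hs b hb hy
  have h := hb.1 i (b.repr y) (by
    by_contra! hcon
    refine hy0 (hsum.symm.trans (Finset.sum_eq_zero fun j hj => ?_))
    rw [hcon j (Finset.ne_of_mem_erase hj), zero_smul])
  rwa [hsum] at h

theorem support_apply_basis_eq_zero [FiniteDimensional ℝ X] (hs : IsSupportMap s)
    (b : Module.Basis ι ℝ X) (hb : IsStronglyOrthonormal b) {i : ι}
    (hco : IsBestCoapproximation (Submodule.span ℝ (b '' {j | j ≠ i})) (b i) 0)
    {y : X} (hy0 : y ≠ 0) (hy : s (b i) y = 0) : s y (b i) = 0 := by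
  have hmem : y ∈ Submodule.span ℝ (b '' {j | j ≠ i}) := by
    rw [← sum_erase_eq_of_support_apply_eq_zero hs b hb hy]
    exact Submodule.sum_mem _ fun j hj => Submodule.smul_mem _ _
      (Submodule.subset_span ⟨j, Finset.ne_of_mem_erase hj, rfl⟩)
  refine hs.apply_eq_zero_of_norm_le hy0 fun t => ?_
  rcases eq_or_ne t 0 with rfl | ht
  · simp
  have h := hco.2 _ (Submodule.smul_mem _ (-t⁻¹) hmem)
  have h1 : y + t • b i = t • (b i - (-t⁻¹) • y) := by
    rw [smul_sub, smul_smul, mul_neg, mul_inv_cancel₀ ht]; module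
  have h2 : ‖y‖ = |t| * ‖0 - (-t⁻¹) • y‖ := by
    rw [zero_sub, norm_neg, norm_smul, norm_neg, norm_inv, Real.norm_eq_abs,
      mul_inv_cancel_left₀ (abs_ne_zero.2 ht)]
  rw [h1, h2, norm_smul, Real.norm_eq_abs]
  gcongr

end Basis

section InnerProduct

variable {X : Type*} [NormedAddCommGroup X] [InnerProductSpace ℝ X]

theorem norm_le_norm_add_of_inner_eq_zero {x y : X} (h : inner ℝ x y = 0) :
    ‖x‖ ≤ ‖x + y‖ := by
  have := norm_add_sq_eq_norm_sq_add_norm_sq_real h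
  nlinarith [norm_nonneg x, norm_nonneg (x + y), mul_self_nonneg ‖y‖]

theorem norm_lt_norm_add_of_inner_eq_zero {x y : X} (h : inner ℝ x y = 0) (hy : y ≠ 0) :
    ‖x‖ < ‖x + y‖ := by
  have := norm_add_sq_eq_norm_sq_add_norm_sq_real h
  have := norm_pos_iff.2 hy
  nlinarith [norm_nonneg x, norm_nonneg (x + y), mul_self_nonneg ‖y‖]

variable {ι : Type*} [Fintype ι]

theorem OrthonormalBasis.isStronglyOrthonormal [DecidableEq ι]
    (b : OrthonormalBasis ι ℝ X) :
    IsStronglyOrthonormal b.toBasis := by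
  refine ⟨fun i c ⟨j, hj, hc⟩ => ?_, fun i => by simp⟩
  simp only [OrthonormalBasis.coe_toBasis]
  refine norm_lt_norm_add_of_inner_eq_zero ?_ fun h => hc ?_
  · rw [inner_sum]
    refine Finset.sum_eq_zero fun k hk => ?_
    rw [inner_smul_right, b.inner_eq_zero (Finset.ne_of_mem_erase hk).symm, mul_zero]
  · exact linearIndependent_iff'.1 b.toBasis.linearIndependent (Finset.univ.erase i) c
      (by simpa using h) j (by simp [hj])

theorem OrthonormalBasis.isBestCoapproximation_zero (b : OrthonormalBasis ι ℝ X) (i : ι) :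
    IsBestCoapproximation (Submodule.span ℝ (b.toBasis '' {j | j ≠ i})) (b.toBasis i) 0 := by
  refine ⟨Submodule.zero_mem _, fun g hg => ?_⟩
  have hzero : inner ℝ g (b i) = 0 := by
    induction hg using Submodule.span_induction with
    | mem x hx =>
      obtain ⟨j, hj, rfl⟩ := hx
      simpa using b.inner_eq_zero hj
    | zero => simp
    | add x y _ _ hx hy => rw [inner_add_left, hx, hy, add_zero]
    | smul r x _ hx => rw [inner_smul_left, hx, mul_zero]
  have h := norm_le_norm_add_of_inner_eq_zero (x := g) (y := -b i)
    (by rw [inner_neg_right, hzero, neg_zero])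
  rw [zero_sub, norm_neg, OrthonormalBasis.coe_toBasis, norm_sub_rev, sub_eq_add_neg]
  exact h

theorem exists_orthonormalBasis_mem_range [FiniteDimensional ℝ X] {e : X} (he : ‖e‖ = 1) :
    ∃ b : OrthonormalBasis (Fin (Module.finrank ℝ X)) ℝ X, e ∈ Set.range b := by
  have hpos : 0 < Module.finrank ℝ X :=
    Module.finrank_pos_iff_exists_ne_zero.2 ⟨e, norm_pos_iff.1 (he ▸ one_pos)⟩
  have ho : Orthonormal ℝ (({⟨0, hpos⟩} : Set (Fin (Module.finrank ℝ X))).domRestrict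
      fun _ => e) :=
    ⟨fun _ => he, fun i j hij => absurd (Subsingleton.elim i j) hij⟩
  obtain ⟨b, hb⟩ := ho.exists_orthonormalBasis_extension_of_card_eq (by simp)
  exact ⟨b, _, hb _ rfl⟩

end InnerProduct

theorem mainTheorem3 (X : Type*) [NormedAddCommGroup X] [NormedSpace ℝ X]
    [FiniteDimensional ℝ X] (hsmooth : IsSmoothNormedSpace X)
    (hdim : 3 ≤ Module.finrank ℝ X) :
    IsInnerProductNormedSpace X ↔
      ∀ e : X, ‖e‖ = 1 →
        ∃ b : Module.Basis (Fin (Module.finrank ℝ X)) ℝ X,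
          e ∈ Set.range b ∧
          IsStronglyOrthonormal b ∧
          ∀ i, IsBestCoapproximation (Submodule.span ℝ (b '' {j | j ≠ i})) (b i) 0 := by
  constructor
  · rintro ⟨I, rfl⟩ e he
    obtain ⟨b, hb⟩ := exists_orthonormalBasis_mem_range he
    exact ⟨b.toBasis, by simpa using hb, b.isStronglyOrthonormal, b.isBestCoapproximation_zero⟩
  · intro h
    obtain ⟨s, hs⟩ := hsmooth.exists_isSupportMap
    refine hs.isInnerProductNormedSpace hdim (fun x y hx hy hxy => ?_) fun x y hx hy hxy => ?_
    all_goals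
      have hx0 : 0 < ‖x‖ := norm_pos_iff.2 hx
      obtain ⟨b, ⟨i, hi⟩, hb, hco⟩ := h (‖x‖⁻¹ • x) (norm_smul_inv_norm (𝕜 := ℝ) hx)
      have hsi : s (b i) = s x := by rw [hi, hs.smul_of_pos (inv_pos.2 hx0) hx]
    · have h1 := support_apply_basis_eq_zero hs b hb (hco i) hy (by rw [hsi, hxy])
      rw [hi, map_smul, smul_eq_mul] at h1
      exact (mul_eq_zero.1 h1).resolve_left (inv_pos.2 hx0).ne'
    · have h1 := norm_lt_norm_add_of_support_apply_eq_zero hs b hb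
        (smul_ne_zero (inv_pos.2 hx0).ne' hy) (by rw [hsi, map_smul, hxy, smul_zero])
      rw [hi, ← smul_add, norm_smul, norm_smul] at h1
      exact lt_of_mul_lt_mul_left h1 (norm_nonneg _)
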